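/- Let $\mathsf{Ree}(3)={}^2G_2(3)$ be the smallest Ree group, that is, the subgroup of $\mathrm{GL}(7,3)$ given by its natural $7$-dimensional representation over $\mathbb{F}_3$; it has order $1512$ and is isomorphic to $\mathsf{P\Gamma L}(2,8)$. The Ree unital $\mathcal{R}(3)$ is the incidence structure whose points are the Sylow $3$-subgroups of $\mathsf{Ree}(3)$ and whose blocks are the sets of points fixed, under conjugation, by an involution of $\mathsf{Ree}(3)$; an involution $a$ is identified with the block $\{P : P^a=P\}$. For a field $F$, an embedding $\varphi:\mathcal{R}(3)\to\mathsf{PG}(2,F)$ is an injective map that sends points to points and blocks to lines and satisfies, for every point $P$ and every block $b$: $P$ is on $b$ if and only if $\varphi(P)$ is on $\varphi(b)$. Let $F$ be a field, let $\varphi:\mathcal{R}(3)\to\mathsf{PG}(2,F)$ be an embedding, and let $S$ be a Sylow $2$-subgroup of $\mathsf{Ree}(3)$. Then $S=\{1,a_1,\dots,a_7\}$ has order $8$, each $a_i$ is an involution, and the seven lines $\varphi(a_1),\dots,\varphi(a_7)$ are concurrent: some point of $\mathsf{PG}(2,F)$ lies on all of them. -/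

import Mathlib

open scoped LinearAlgebra.Projectivization

/-! ### The Ree groups `²G₂(q)` -/

section ReeGroup

variable {K : Type*} [Field K]

/-- The standard elements `α(x)`, `β(x)`, `γ(x)` generate a Sylow `3`-subgroup of the Ree group in
its natural `7`-dimensional representation. Here `q = 3 ^ (2 * m + 1)` and `t = 3 ^ m`. -/
def reeAlpha (m : ℕ) (x : K) : Matrix (Fin 7) (Fin 7) K :=
  let t : ℕ := 3 ^ m
  !![1, x ^ t, 0, 0, -x ^ (3 * t + 1), -x ^ (3 * t + 2), x ^ (4 * t + 2);
     0, 1, x, x ^ (t + 1), -x ^ (2 * t + 1), 0, -x ^ (3 * t + 2);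
     0, 0, 1, x ^ t, -x ^ (2 * t), 0, x ^ (3 * t + 1);
     0, 0, 0, 1, x ^ t, 0, 0;
     0, 0, 0, 0, 1, -x, x ^ (t + 1);
     0, 0, 0, 0, 0, 1, -x ^ t;
     0, 0, 0, 0, 0, 0, 1]

/-- The element `β(x)`. -/
def reeBeta (m : ℕ) (x : K) : Matrix (Fin 7) (Fin 7) K :=
  let t : ℕ := 3 ^ m
  !![1, 0, -x ^ t, 0, -x, 0, -x ^ (t + 1);
     0, 1, 0, x ^ t, 0, -x ^ (2 * t), 0;
     0, 0, 1, 0, 0, 0, x;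
     0, 0, 0, 1, 0, x ^ t, 0;
     0, 0, 0, 0, 1, 0, x ^ t;
     0, 0, 0, 0, 0, 1, 0;
     0, 0, 0, 0, 0, 0, 1]

/-- The element `γ(x)`. -/
def reeGamma (m : ℕ) (x : K) : Matrix (Fin 7) (Fin 7) K :=
  let t : ℕ := 3 ^ m
  !![1, 0, 0, -x ^ t, 0, -x, -x ^ (2 * t);
     0, 1, 0, 0, -x ^ t, 0, x;
     0, 0, 1, 0, 0, x ^ t, 0;
     0, 0, 0, 1, 0, 0, -x ^ t;
     0, 0, 0, 0, 1, 0, 0;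
     0, 0, 0, 0, 0, 1, 0;
     0, 0, 0, 0, 0, 0, 1]

/-- The torus element
`h(s) = diag(s^t, s^(1-t), s^(2t-1), 1, s^(1-2t), s^(t-1), s^(-t))`, where `t = 3 ^ m`. -/
def reeTorus (m : ℕ) (s : Kˣ) : Matrix (Fin 7) (Fin 7) K :=
  let t : ℤ := 3 ^ m
  Matrix.diagonal ![((s ^ t : Kˣ) : K), ((s ^ (1 - t) : Kˣ) : K), ((s ^ (2 * t - 1) : Kˣ) : K), 1,
    ((s ^ (1 - 2 * t) : Kˣ) : K), ((s ^ (t - 1) : Kˣ) : K), ((s ^ (-t) : Kˣ) : K)]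

/-- The Weyl element: the antidiagonal matrix with all antidiagonal entries `-1`. -/
def reeWeyl : Matrix (Fin 7) (Fin 7) K :=
  Matrix.of fun i j => if j = Fin.rev i then -1 else 0

variable (K)

/-- The Ree group `Ree(q) = ²G₂(q)`, `q = 3 ^ (2 * m + 1)`, for a field `K` with `q` elements, in
its natural `7`-dimensional representation. It is generated by a Sylow `3`-subgroup, a maximal
torus normalizing it, and the nontrivial element of the Weyl group. -/
def reeGroup (m : ℕ) : Subgroup (GL (Fin 7) K) :=
  Subgroup.closure {g : GL (Fin 7) K |
    (∃ x : K, (g : Matrix (Fin 7) (Fin 7) K) = reeAlpha m x) ∨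
    (∃ x : K, (g : Matrix (Fin 7) (Fin 7) K) = reeBeta m x) ∨
    (∃ x : K, (g : Matrix (Fin 7) (Fin 7) K) = reeGamma m x) ∨
    (∃ s : Kˣ, (g : Matrix (Fin 7) (Fin 7) K) = reeTorus m s) ∨
    (g : Matrix (Fin 7) (Fin 7) K) = reeWeyl}

end ReeGroup

/-- The smallest Ree group `Ree(3) = ²G₂(3)`. -/
abbrev Ree3 : Type := reeGroup (ZMod 3) 0

/-! ### The Ree unital -/

section Unital

/-- For `G = Ree(q)`, the points of the Ree unital are the Sylow `3`-subgroups of `G`. -/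
abbrev UnitalPoint (G : Type*) [Group G] := Sylow 3 G

/-- For `G = Ree(q)`, the blocks of the Ree unital are the sets of points that are fixed (under
conjugation) by an involution of `G`. -/
def UnitalBlock (G : Type*) [Group G] :=
  {B : Set (UnitalPoint G) // ∃ t : G, orderOf t = 2 ∧ B = MulAction.fixedBy (UnitalPoint G) t}

instance (G : Type*) [Group G] : Membership (UnitalPoint G) (UnitalBlock G) :=
  ⟨fun B P => P ∈ B.1⟩

/-- An involution viewed as a block: the set of its fixed points. -/
def involutionBlock {G : Type*} [Group G] (t : G) (ht : orderOf t = 2) : UnitalBlock G :=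
  ⟨MulAction.fixedBy (UnitalPoint G) t, t, ht, rfl⟩

end Unital

/-! ### Embeddings -/

/-- An embedding of an incidence structure with points `P` and blocks `B` into one with points
`P'` and lines `L'`. -/
structure IncidenceEmbedding (P B P' L' : Type*) [Membership P B] [Membership P' L'] where
  onPoints : P → P'
  onBlocks : B → L'
  onPoints_injective : Function.Injective onPoints
  onBlocks_injective : Function.Injective onBlocks
  mem_iff : ∀ (p : P) (b : B), p ∈ b ↔ onPoints p ∈ onBlocks b

/-- The points of `PG(2,F)`. -/
abbrev PGPoint (F : Type*) [Field F] := ℙ F (Fin 3 → F)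

/-- The lines of `PG(2,F)`, given by homogeneous line coordinates. The incidence `p ∈ l` is
Mathlib's: the dot product of the coordinate vectors of `p` and `l` vanishes. -/
abbrev PGLine (F : Type*) [Field F] := ℙ F (Fin 3 → F)

open scoped Matrix

namespace ReeThree

/-! ### Matrices over the field with three elements, encoded by numerals -/

/-! The group theory is made explicit first. `Ree3` permutes 28 flags, the cosets of a Borel
subgroup (`exists_isBorel`), and the first columns of the coset representatives, up to sign, form
one orbit of 56 vectors. The stabilizer of a vector is conjugate to a unitriangular group, so it is
a 3-group; its index 56 is prime to 3, so it is a Sylow 3-subgroup. Hence the points of the unital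
are the pairs ±v, and a Sylow 2-subgroup has order 8. By Sylow's theorem it is conjugate to
`sylowTwoSubgroup`, so moving the embedding by the conjugating element leaves seven fixed
involutions with known fixed points.

What remains is coordinate geometry with 28 points and 23 blocks (`IsRealization`). With four points
as standard frame, a single parameter a is left, and joining points and intersecting lines spreads
coordinates polynomial in a. Two closing incidences give a³ - a + 1 = 0 and 2a = 0. So the
characteristic is 2, and the seven lines meet in (1, a² + a + 1, 1) (`exists_concurrent_of_frame`).
-/

/-- Square matrices of order `7` over the field with three elements. -/
abbrev Mat7 : Type := Matrix (Fin 7) (Fin 7) (ZMod 3)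

/-- The digit of `N` in base `3` at position `(i, j)`. -/
def entry (N i j : ℕ) : ℕ := N / 3 ^ (7 * i + j) % 3

/-- The matrix encoded by the base `3` digits of a natural number, row by row. -/
def ofCode (N : ℕ) : Mat7 := .of fun i j => (entry N i j : ZMod 3)

/-- The entries of a product of two encoded matrices, up to reduction modulo `3`. -/
def mulEntry (M N i j : ℕ) : ℕ :=
  entry M i 0 * entry N 0 j + entry M i 1 * entry N 1 j + entry M i 2 * entry N 2 j +
    entry M i 3 * entry N 3 j + entry M i 4 * entry N 4 j + entry M i 5 * entry N 5 j +
    entry M i 6 * entry N 6 j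

/-- The entries of a product of three encoded matrices, up to reduction modulo `3`. -/
def mulEntry₃ (L M N i j : ℕ) : ℕ :=
  entry L i 0 * mulEntry M N 0 j + entry L i 1 * mulEntry M N 1 j +
    entry L i 2 * mulEntry M N 2 j + entry L i 3 * mulEntry M N 3 j +
    entry L i 4 * mulEntry M N 4 j + entry L i 5 * mulEntry M N 5 j +
    entry L i 6 * mulEntry M N 6 j

lemma ofCode_mul_apply (M N : ℕ) (i j : Fin 7) :
    (ofCode M * ofCode N) i j = (mulEntry M N i j : ZMod 3) := by
  simp [ofCode, mulEntry, Matrix.mul_apply, Fin.sum_univ_seven]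

lemma ofCode_mul_mul_apply (L M N : ℕ) (i j : Fin 7) :
    (ofCode L * (ofCode M * ofCode N)) i j = (mulEntry₃ L M N i j : ZMod 3) := by
  rw [Matrix.mul_apply, Fin.sum_univ_seven]
  simp only [ofCode_mul_apply]
  simp [mulEntry₃, ofCode]

lemma natCast_eq_of_mod_eq {m n : ℕ} (h : m % 3 = n % 3) : (m : ZMod 3) = n :=
  (ZMod.natCast_eq_natCast_iff' m n 3).2 h

lemma ofCode_mul_eq_one {M N : ℕ}
    (h : ∀ i j : Fin 7, mulEntry M N i j % 3 = if i = j then 1 else 0) :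
    ofCode M * ofCode N = 1 := by
  ext i j
  rw [ofCode_mul_apply, Matrix.one_apply, natCast_eq_of_mod_eq (n := if i = j then 1 else 0)]
  · split_ifs <;> simp
  · rw [h]; split_ifs <;> rfl

/-! ### Generators of `Ree(3)` and the flags of the ovoid -/

/-- Codes of the matrices of a generating set of `Ree(3)`. -/
def letterCode : Fin 8 → ℕ := ![
    79851576384543085582225, 79815097829952764237878, 79778619275361281636635,
    79778635955088333974893, 79778602610886587415823, 79778602603262153609209,
    159545047525526969995691, 219138579881517884238]

/-- Codes of the inverses of the generators. -/
def letterInvCode : Fin 8 → ℕ := ![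
    79815081157860608893600, 79851559712449764610201, 79778635955088333974893,
    79778619275361281636635, 79778602603262153609209, 79778602610886587415823,
    159545047525526969995691, 219138579881517884238]

/-- Codes of representatives of the cosets of the Borel subgroup. -/
def cosetCode : Fin 28 → ℕ := ![
    79778602595634228233767, 219138579881517884238, 219188725999176904151,
    219238780379126243369, 219138625697874604066, 219188703206095913725,
    219238826080380794234, 219138602789696247568, 219188680287447651155,
    219238803276825101665, 219138579892006959343, 219188726009656422074,
    219238780358186350376, 219138625708363674800, 219188703185151327392,
    219238826090865029488, 219138602800185320483, 219188680297884100483,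
    219238803287266285829, 219138579902452981165, 219188726020107163414,
    219238780368627595777, 219138625718809698803, 219188703195602064389,
    219238826101306277108, 219138602810631346676, 219188680276996833263,
    219238803266369522642]

/-- Codes of the inverses of the coset representatives. -/
def cosetInvCode : Fin 28 → ℕ := ![
    79778602595634228233767, 219138579881517884238, 206401462094261197924992,
    234338866256851331466978, 99694524897330034605408, 128650506467509442022705,
    233355462878476387667295, 89848183406938647547986, 210408071624413895504844,
    158481821417993702399565, 139116419468765671984893, 194653126957152646919025,
    195904455414236029287855, 185450650064676352916892, 214309336933943113115682,
    150581996098012159606179, 202120176940488127574451, 83356437250732639295232,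
    173224989261748307796309, 109605718395916455879135, 120706108599905257045905,
    86602979279291282249526, 182455817358030298526115, 175850594106104789867349,
    218575805361162911817579, 225750631589176747257864, 222205087454903773225722,
    188089750437275182147632]

/-- The action of the generators on the cosets of the Borel subgroup, as numbers with base `56`
digits: if the `i`-th digit of entry `k` is `j < 28`, then generator `k` maps the first column of
the `i`-th coset representative to that of the `j`-th one; if it is `j + 28`, to the negative of
that column. -/
def moveCode : Fin 8 → ℕ := ![
    2620057492004570017268763898026963396695977516848, 3181579643580677276907817872676797012998705944208,
    508828382420421381297005984817478998410389798048, 2398552610643872437548034906862901352770518498248,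
    1453002381475956643281903579553495517848276861168, 2908946063319271908165665295139188686876602998568,
    6788828143400816772368338570909843659329343692532, 8738072998399607583369202838837595097810742458241]

/-- The index of an ovoid point from the index of a signed ovoid vector. -/
def unsign (s : Fin 56) : Fin 28 := ⟨s % 28, Nat.mod_lt _ (by decide)⟩

/-- The sign, modulo `3`, of a signed ovoid vector. -/
def sign (s : Fin 56) : ℕ := if s.1 < 28 then 1 else 2

/-- The signed ovoid vector to which a generator maps an ovoid vector. -/
def moveBase (k : Fin 8) (i : Fin 28) : Fin 56 :=
  ⟨moveCode k / 56 ^ i.1 % 56, Nat.mod_lt _ (by decide)⟩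

/-- The signed action of a generator on the indices of signed ovoid vectors. -/
def move (k : Fin 8) (s : Fin 56) : Fin 56 :=
  ⟨((moveBase k (unsign s)).1 + s / 28 * 28) % 56, Nat.mod_lt _ (by decide)⟩

/-- Upper triangular matrices whose diagonal has the shape `d, 1, d, 1, d, 1, d`. -/
def IsBorel (d : ZMod 3) (M : Mat7) : Prop :=
  (∀ i j, j < i → M i j = 0) ∧ ∀ i, M i i = if i.1 % 2 = 1 then 1 else d

lemma isBorel_one : IsBorel 1 1 :=
  ⟨fun _ _ h => Matrix.one_apply_ne h.ne', fun i => by simp⟩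

lemma IsBorel.mul {d e : ZMod 3} {M N : Mat7} (hM : IsBorel d M) (hN : IsBorel e N) :
    IsBorel (d * e) (M * N) := by
  refine ⟨fun i j hij => ?_, fun i => ?_⟩
  · rw [Matrix.mul_apply]
    refine Finset.sum_eq_zero fun k _ => ?_
    rcases lt_or_ge k i with h | h
    · rw [hM.1 _ _ h, zero_mul]
    · rw [hN.1 _ _ (hij.trans_le h), mul_zero]
  · have key : (M * N) i i = M i i * N i i := by
      rw [Matrix.mul_apply, Finset.sum_eq_single i _ (by simp)]
      intro k _ hk
      rcases lt_or_gt_of_ne hk with h | h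
      · rw [hM.1 _ _ h, zero_mul]
      · rw [hN.1 _ _ h, mul_zero]
    rw [key, hM.2 i, hN.2 i]
    split_ifs <;> simp

/-- An upper unitriangular matrix of order `7` in characteristic `3` has order dividing `9`. -/
lemma IsBorel.pow_nine {M : Mat7} (hM : IsBorel 1 M) : M ^ 9 = 1 := by
  have hc : M.charpoly = (Polynomial.X - Polynomial.C 1) ^ 7 := by
    rw [Matrix.charpoly_of_isUpperTriangular M fun i j hij => hM.1 i j hij]
    have hd : ∀ i, M i i = 1 := fun i => by rw [hM.2 i, ite_self]
    simp [hd]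
  have h7 : (M - 1) ^ 7 = 0 := by
    have := Matrix.aeval_self_charpoly M
    rwa [hc, map_pow, map_sub, Polynomial.aeval_X, Polynomial.aeval_C, map_one] at this
  -- Cayley–Hamilton kills the 7th power of M - 1; 9 is the first power of 3 beyond 7, and there the
  -- Frobenius identity applies.
  have h9 : (M - 1) ^ (3 ^ 2) = M ^ (3 ^ 2) - 1 ^ (3 ^ 2) :=
    sub_pow_char_pow_of_commute (p := 3) 2 (Commute.one_right M)
  rw [show (3 : ℕ) ^ 2 = 7 + 2 from rfl, pow_add, h7, zero_mul, one_pow] at h9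
  exact sub_eq_zero.1 h9.symm

set_option maxRecDepth 100000

lemma letter_mul_inv (k : Fin 8) : ofCode (letterCode k) * ofCode (letterInvCode k) = 1 :=
  ofCode_mul_eq_one (by revert k; decide +kernel)

lemma coset_mul_inv (i : Fin 28) : ofCode (cosetCode i) * ofCode (cosetInvCode i) = 1 :=
  ofCode_mul_eq_one (by revert i; decide +kernel)

lemma coset_inv_mul (i : Fin 28) : ofCode (cosetInvCode i) * ofCode (cosetCode i) = 1 :=
  mul_eq_one_comm.1 (coset_mul_inv i)

/-- A finite check done in `ℕ`, where the kernel evaluates quickly. The diagonal pattern is that of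
the torus element h(±1) for m = 0. -/
lemma mulEntry₃_letter : ∀ (k : Fin 8) (i : Fin 28) (r c : Fin 7), c ≤ r →
    mulEntry₃ (cosetInvCode (unsign (moveBase k i))) (letterCode k) (cosetCode i) r c % 3 =
      if c < r then 0 else if r.1 % 2 = 1 then 1 else sign (moveBase k i) := by
  decide +kernel

/-- The generators permute the flags attached to the ovoid points. -/
lemma isBorel_letter (k : Fin 8) (i : Fin 28) :
    IsBorel (sign (moveBase k i)) (ofCode (cosetInvCode (unsign (moveBase k i))) *
      (ofCode (letterCode k) * ofCode (cosetCode i))) := by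
  refine ⟨fun r c h => ?_, fun r => ?_⟩ <;> rw [ofCode_mul_mul_apply]
  · rw [natCast_eq_of_mod_eq (n := 0), Nat.cast_zero]
    simpa [h] using mulEntry₃_letter k i r c h.le
  · rw [natCast_eq_of_mod_eq (n := if r.1 % 2 = 1 then 1 else sign (moveBase k i))]
    · split_ifs <;> simp
    · rw [mulEntry₃_letter k i r r le_rfl, if_neg (lt_irrefl _)]
      unfold sign
      split_ifs <;> rfl

/-- The `56` signed ovoid vectors. -/
def ovoidVec (s : Fin 56) : Fin 7 → ZMod 3 :=
  (sign s : ZMod 3) • fun r => ofCode (cosetCode (unsign s)) r 0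

/-- The generators as elements of `Ree(3)`. -/
def gen (k : Fin 8) : Ree3 :=
  ⟨⟨ofCode (letterCode k), ofCode (letterInvCode k), letter_mul_inv k,
    mul_eq_one_comm.1 (letter_mul_inv k)⟩, Subgroup.subset_closure <| by
    change (∃ x : ZMod 3, ofCode (letterCode k) = reeAlpha 0 x) ∨
      (∃ x : ZMod 3, ofCode (letterCode k) = reeBeta 0 x) ∨
      (∃ x : ZMod 3, ofCode (letterCode k) = reeGamma 0 x) ∨
      (∃ x : (ZMod 3)ˣ, ofCode (letterCode k) = reeTorus 0 x) ∨ ofCode (letterCode k) = reeWeyl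
    revert k
    decide +kernel⟩

/-- The parameters x = 0 and s = 1 give the identity; x = ±1, s = -1 and the Weyl element give the
eight letters. -/
lemma eq_one_or_eq_letter {g : GL (Fin 7) (ZMod 3)}
    (hg : (∃ x : ZMod 3, (g : Mat7) = reeAlpha 0 x) ∨ (∃ x : ZMod 3, (g : Mat7) = reeBeta 0 x) ∨
      (∃ x : ZMod 3, (g : Mat7) = reeGamma 0 x) ∨ (∃ s : (ZMod 3)ˣ, (g : Mat7) = reeTorus 0 s) ∨
      (g : Mat7) = reeWeyl) :
    (g : Mat7) = 1 ∨ ∃ k, (g : Mat7) = ofCode (letterCode k) := by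
  have hα : ∀ x : ZMod 3, reeAlpha 0 x = 1 ∨ ∃ k, reeAlpha 0 x = ofCode (letterCode k) := by
    decide +kernel
  have hβ : ∀ x : ZMod 3, reeBeta 0 x = 1 ∨ ∃ k, reeBeta 0 x = ofCode (letterCode k) := by
    decide +kernel
  have hγ : ∀ x : ZMod 3, reeGamma 0 x = 1 ∨ ∃ k, reeGamma 0 x = ofCode (letterCode k) := by
    decide +kernel
  have hτ : ∀ s : (ZMod 3)ˣ, reeTorus 0 s = 1 ∨ ∃ k, reeTorus 0 s = ofCode (letterCode k) := by
    decide +kernel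
  have hw : reeWeyl = ofCode (letterCode 7) := by decide +kernel
  rcases hg with ⟨x, hx⟩ | ⟨x, hx⟩ | ⟨x, hx⟩ | ⟨s, hs⟩ | h
  · exact hx ▸ hα x
  · exact hx ▸ hβ x
  · exact hx ▸ hγ x
  · exact hs ▸ hτ s
  · exact .inr ⟨7, h.trans hw⟩

/-- `Ree(3)` permutes the flags attached to the ovoid points. -/
lemma exists_isBorel (g : Ree3) (i : Fin 28) :
    ∃ d j, IsBorel d (ofCode (cosetInvCode j) *
      ((g : GL (Fin 7) (ZMod 3)) * ofCode (cosetCode i))) := by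
  obtain ⟨g, hg⟩ := g
  change ∃ d j, IsBorel d (ofCode (cosetInvCode j) * ((g : Mat7) * ofCode (cosetCode i)))
  -- In a finite group the generators already generate as a monoid, so the induction needs no case
  -- for inverses.
  rw [← Subgroup.mem_toSubmonoid, reeGroup, Subgroup.closure_toSubmonoid_of_finite] at hg
  have hone : IsBorel 1 (ofCode (cosetInvCode i) * (1 * ofCode (cosetCode i))) := by
    rw [one_mul, coset_inv_mul]
    exact isBorel_one
  induction hg using Submonoid.closure_induction generalizing i with
  | mem g hg =>
    rcases eq_one_or_eq_letter hg with h | ⟨k, h⟩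
    · exact ⟨1, i, h ▸ hone⟩
    · exact ⟨_, _, h ▸ isBorel_letter k i⟩
  | one => exact ⟨1, i, hone⟩
  | mul g₁ g₂ _ _ h₁ h₂ =>
    obtain ⟨d, j, hj⟩ := h₂ i (by rw [one_mul, coset_inv_mul]; exact isBorel_one)
    obtain ⟨e, m, hm⟩ := h₁ j (by rw [one_mul, coset_inv_mul]; exact isBorel_one)
    refine ⟨e * d, m, ?_⟩
    have := hm.mul hj
    rw [mul_assoc, mul_assoc, ← mul_assoc (ofCode (cosetCode j)), coset_mul_inv, one_mul] at this
    simpa [mul_assoc] using this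

/-! ### The action on the ovoid vectors -/

lemma smul_def (g : Ree3) (v : Fin 7 → ZMod 3) :
    g • v = ((g : GL (Fin 7) (ZMod 3)) : Mat7) *ᵥ v := rfl

/-- The first column of a coset representative. -/
def ovoidBase (i : Fin 28) : Fin 7 → ZMod 3 := fun r => ofCode (cosetCode i) r 0

lemma ovoidVec_eq (s : Fin 56) : ovoidVec s = (sign s : ZMod 3) • ovoidBase (unsign s) := rfl

/-- The first column of an upper triangular matrix is a multiple of the first unit vector, so
comparing first columns suffices. -/
lemma IsBorel.smul_ovoidBase {d : ZMod 3} {g : Ree3} {i j : Fin 28}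
    (h : IsBorel d (ofCode (cosetInvCode j) *
      ((g : GL (Fin 7) (ZMod 3)) * ofCode (cosetCode i)))) :
    g • ovoidBase i = d • ovoidBase j := by
  set u := ofCode (cosetInvCode j) * ((g : GL (Fin 7) (ZMod 3)) * ofCode (cosetCode i)) with hu
  have key : (g : GL (Fin 7) (ZMod 3)) * ofCode (cosetCode i) = ofCode (cosetCode j) * u := by
    rw [hu, ← mul_assoc, coset_mul_inv, one_mul]
  ext r
  have hr : ∑ c, ((g : GL (Fin 7) (ZMod 3)) : Mat7) r c * ofCode (cosetCode i) c 0 =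
      ∑ c, ofCode (cosetCode j) r c * u c 0 := congrFun (congrFun key r) 0
  have hsum : ∑ c, ofCode (cosetCode j) r c * u c 0 = ofCode (cosetCode j) r 0 * u 0 0 :=
    Finset.sum_eq_single 0 (fun c _ hc => by rw [h.1 c 0 (Fin.pos_of_ne_zero hc), mul_zero])
      (by simp)
  rw [hsum, h.2 0] at hr
  exact hr.trans (mul_comm _ _)

lemma unsign_move : ∀ k s, unsign (move k s) = unsign (moveBase k (unsign s)) := by
  decide +kernel

lemma sign_move : ∀ k s, sign s * sign (moveBase k (unsign s)) % 3 = sign (move k s) % 3 := by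
  decide +kernel

lemma gen_smul (k : Fin 8) (s : Fin 56) : gen k • ovoidVec s = ovoidVec (move k s) := by
  have hs : (sign s : ZMod 3) * sign (moveBase k (unsign s)) = sign (move k s) := by
    rw [← Nat.cast_mul]
    exact natCast_eq_of_mod_eq (sign_move k s)
  have hb : gen k • ovoidBase (unsign s) = (sign (moveBase k (unsign s)) : ZMod 3) •
      ovoidBase (unsign (moveBase k (unsign s))) :=
    IsBorel.smul_ovoidBase (isBorel_letter k (unsign s))
  calc gen k • ovoidVec s = (sign s : ZMod 3) • gen k • ovoidBase (unsign s) := smul_comm _ _ _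
    _ = ((sign s : ZMod 3) * sign (moveBase k (unsign s))) •
        ovoidBase (unsign (moveBase k (unsign s))) := by rw [hb, smul_smul]
    _ = ovoidVec (move k s) := by rw [hs, ← unsign_move]; rfl

/-- The element of `Ree(3)` represented by a word in the generators. -/
def word (l : List (Fin 8)) : Ree3 := (l.map gen).prod

/-- The action of a word on the indices of signed ovoid vectors. -/
def moveWord (l : List (Fin 8)) (s : Fin 56) : Fin 56 := l.foldr move s

lemma word_smul (l : List (Fin 8)) (s : Fin 56) :
    word l • ovoidVec s = ovoidVec (moveWord l s) := by
  induction l with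
  | nil => exact one_smul _ _
  | cons k l ih =>
    rw [word, List.map_cons, List.prod_cons, mul_smul, ← word, ih, gen_smul, moveWord, moveWord,
      List.foldr_cons]

lemma word_append (l m : List (Fin 8)) : word (l ++ m) = word l * word m := by
  simp [word]

/-- 18 is a common multiple of the orders of the eight permutations; this gives bijectivity without
inverse letters. -/
lemma move_iterate : ∀ k s, (move k)^[18] s = s := by decide +kernel

lemma move_surjective (k : Fin 8) : Function.Surjective (move k) := fun s =>
  ⟨(move k)^[17] s, by rw [← Function.iterate_succ_apply' (move k) 17, move_iterate]⟩

lemma moveWord_surjective (l : List (Fin 8)) : Function.Surjective (moveWord l) := by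
  induction l with
  | nil => exact fun s => ⟨s, rfl⟩
  | cons k l ih => exact (move_surjective k).comp ih

/-- A word that maps the first ovoid vector to a given one. -/
def wordTo (s : Fin 56) : List (Fin 8) :=
  -- Bruhat decomposition: with letters 0, 2, 4, 7 equal to α(1), β(1), γ(1) and the Weyl element w,
  -- the other 27 points are the images of point 0 under αⁱβʲγᵏw. The final letter 6 is h(-1); it
  -- acts first and negates vector 0.
  (if (unsign s).1 = 0 then [] else
    let n := (unsign s).1 - 1
    List.replicate (n % 3) 0 ++ List.replicate (n / 3 % 3) 2 ++ List.replicate (n / 9) 4 ++ [7]) ++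
  if s.1 < 28 then [] else [6]

lemma moveWord_wordTo : ∀ s, moveWord (wordTo s) 0 = s := by decide +kernel

lemma ovoidVec_eq_ovoidVec_zero : ∀ s, ovoidVec s = ovoidVec 0 → s = 0 := by decide +kernel

/-- Transitivity reduces this to comparisons with vector 0. -/
lemma ovoidVec_injective : Function.Injective ovoidVec := by
  intro s t h
  obtain ⟨t', rfl⟩ := moveWord_surjective (wordTo s) t
  rw [← word_smul, ← moveWord_wordTo s, ← word_smul, moveWord_wordTo s, smul_left_cancel_iff] at h
  rw [ovoidVec_eq_ovoidVec_zero t' h.symm, moveWord_wordTo]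

/-- The elements of `Ree(3)` are determined by their action on the ovoid vectors. -/
lemma ext_of_smul_ovoidVec {g h : Ree3} (hgh : ∀ s, g • ovoidVec s = h • ovoidVec s) : g = h := by
  -- The vectors with these seven indices form a basis: the numeral encodes the matrix with these
  -- columns, and the numeral in `hN` encodes its inverse.
  have hM' : ∀ p : Fin 7 × Fin 7, ofCode 238986391606184130682582 p.1 p.2 =
      ovoidVec (![0, 1, 2, 3, 4, 5, 10] p.2) p.1 := by decide +kernel
  have hM : ∀ r c, ofCode 238986391606184130682582 r c =
      ovoidVec (![0, 1, 2, 3, 4, 5, 10] c) r := fun r c => hM' (r, c)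
  have hN : ofCode 238986391606184130682582 * ofCode 27276107652575082875062 = 1 :=
    ofCode_mul_eq_one (by decide +kernel)
  have key : ((g : GL (Fin 7) (ZMod 3)) : Mat7) * ofCode 238986391606184130682582 =
      ((h : GL (Fin 7) (ZMod 3)) : Mat7) * ofCode 238986391606184130682582 := by
    ext r c
    have := congrFun (hgh (![0, 1, 2, 3, 4, 5, 10] c)) r
    simp only [smul_def, Matrix.mulVec, dotProduct, ← hM] at this
    simpa only [Matrix.mul_apply] using this
  have := congrArg (· * ofCode 27276107652575082875062) key
  simp only [mul_assoc, hN, mul_one] at this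
  exact Subtype.ext (Units.ext this)

lemma word_eq_word {l m : List (Fin 8)} (h : ∀ s, moveWord l s = moveWord m s) :
    word l = word m :=
  ext_of_smul_ovoidVec fun s => by rw [word_smul, word_smul, h]

/-! ### Sylow subgroups of `Ree(3)` -/

lemma exists_smul_ovoidVec_zero (g : Ree3) : ∃ t, g • ovoidVec 0 = ovoidVec t := by
  obtain ⟨d, j, h⟩ := exists_isBorel g 0
  have hd : ∀ (d : ZMod 3) (j : Fin 28), d = 0 ∨ ∃ t, sign t = d ∧ unsign t = j := by
    decide +kernel
  have h0 : ovoidVec 0 ≠ 0 := by decide +kernel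
  have h1 : ovoidVec 0 = ovoidBase 0 := one_smul _ _
  have hg : g • ovoidVec 0 = d • ovoidBase j := h1 ▸ h.smul_ovoidBase
  obtain rfl | ⟨t, rfl, rfl⟩ := hd d j
  · rw [zero_smul, smul_eq_zero_iff_eq] at hg
    exact absurd hg h0
  · exact ⟨t, hg⟩

lemma orbit_ovoidVec : MulAction.orbit Ree3 (ovoidVec 0) = Set.range ovoidVec := by
  ext v
  constructor
  · rintro ⟨g, rfl⟩
    obtain ⟨t, ht⟩ := exists_smul_ovoidVec_zero g
    exact ⟨t, ht.symm⟩
  · rintro ⟨s, rfl⟩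
    exact ⟨word (wordTo s), by simp only [word_smul, moveWord_wordTo]⟩

lemma index_stabilizer : (MulAction.stabilizer Ree3 (ovoidVec 0)).index = 56 := by
  rw [MulAction.index_stabilizer, orbit_ovoidVec, Set.ncard_range_of_injective ovoidVec_injective]
  simp

/-- Coset representative 0 is the identity, so an element fixing vector 0 is itself upper
unitriangular and `IsBorel.pow_nine` applies. -/
lemma isPGroup_stabilizer : IsPGroup 3 (MulAction.stabilizer Ree3 (ovoidVec 0)) := by
  rintro ⟨g, hg⟩
  obtain ⟨d, j, h⟩ := exists_isBorel g 0
  have hd : ∀ (d : ZMod 3) (j : Fin 28), d • ovoidBase j = ovoidBase 0 → d = 1 ∧ j = 0 := by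
    decide +kernel
  have h1 : ovoidVec 0 = ovoidBase 0 := one_smul _ _
  obtain ⟨rfl, rfl⟩ := hd d j (h.smul_ovoidBase.symm.trans (h1 ▸ hg))
  have hc : ofCode (cosetCode 0) = 1 := by decide +kernel
  have hc' : ofCode (cosetInvCode 0) = 1 := by decide +kernel
  rw [hc, hc', mul_one, one_mul] at h
  exact ⟨2, Subtype.ext (Subtype.ext (Units.ext h.pow_nine))⟩

/-- The group order is 3ⁿ · 56 with 56 = 2³ · 7; the value of n does not matter. -/
lemma card_sylow_two (S : Sylow 2 Ree3) : Nat.card S = 8 := by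
  obtain ⟨n, hn⟩ := IsPGroup.iff_card.1 isPGroup_stabilizer
  have h := (MulAction.stabilizer Ree3 (ovoidVec 0)).card_mul_index
  rw [hn, index_stabilizer] at h
  have h56 : Nat.factorization 56 2 = 3 := by
    rw [show 56 = 2 ^ 3 * 7 from rfl, Nat.factorization_mul (by decide) (by decide),
      Finsupp.add_apply, Nat.factorization_pow_self Nat.prime_two,
      Nat.factorization_eq_zero_of_not_dvd (by decide)]
  have h3 : Nat.factorization (3 ^ n) 2 = 0 :=
    Nat.factorization_eq_zero_of_not_dvd fun h =>
      absurd (Nat.prime_two.dvd_of_dvd_pow h) (by decide)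
  rw [Sylow.card_eq_multiplicity, ← h, Nat.factorization_mul (by positivity) (by decide),
    Finsupp.add_apply, h56, h3]
  norm_num

/-- The point of the Ree unital attached to a signed ovoid vector. -/
def sylowThree (s : Fin 56) : UnitalPoint Ree3 :=
  word (wordTo s) • (isPGroup_stabilizer.toSylow (by rw [index_stabilizer]; decide))

lemma coe_sylowThree (s : Fin 56) :
    (sylowThree s : Subgroup Ree3) = MulAction.stabilizer Ree3 (ovoidVec s) := by
  conv_rhs => rw [← moveWord_wordTo s, ← word_smul, MulAction.stabilizer_smul_eq_stabilizer_map_conj]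
  rfl

lemma word_smul_sylowThree (l : List (Fin 8)) (s : Fin 56) :
    word l • sylowThree s = sylowThree (moveWord l s) := by
  apply Sylow.ext
  rw [coe_sylowThree, ← word_smul, MulAction.stabilizer_smul_eq_stabilizer_map_conj,
    ← coe_sylowThree]
  rfl

/-! ### Points and blocks of the Ree unital -/

/-- Opposite vectors have the same stabilizer. Conversely, after transport to vector 0, the
stabilizer contains `gen 0`, whose only fixed vectors are those of index 0 and 28, an opposite pair.
-/
lemma sylowThree_eq_iff {s t : Fin 56} : sylowThree s = sylowThree t ↔ unsign s = unsign t := by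
  constructor
  · intro h
    obtain ⟨t', rfl⟩ := moveWord_surjective (wordTo s) t
    have hs : sylowThree s = word (wordTo s) • sylowThree 0 := by
      rw [word_smul_sylowThree, moveWord_wordTo]
    rw [hs, ← word_smul_sylowThree, smul_left_cancel_iff] at h
    have h0 : gen 0 ∈ (sylowThree 0 : Subgroup Ree3) := by
      rw [coe_sylowThree, MulAction.mem_stabilizer_iff, gen_smul]
      exact congrArg ovoidVec (by decide +kernel)
    rw [h, coe_sylowThree, MulAction.mem_stabilizer_iff, gen_smul] at h0
    have fix : ∀ t, move 0 t = t → t = 0 ∨ t = 28 := by decide +kernel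
    have key : ∀ s, unsign s = unsign (moveWord (wordTo s) 0) ∧
        unsign s = unsign (moveWord (wordTo s) 28) := by decide +kernel
    rcases fix t' (ovoidVec_injective h0) with rfl | rfl
    · exact (key s).1
    · exact (key s).2
  · intro h
    have hsign : ∀ s t, (sign s : ZMod 3) = sign t ∨ (sign s : ZMod 3) = -sign t := by
      decide +kernel
    apply Sylow.ext
    ext g
    rw [coe_sylowThree, coe_sylowThree, MulAction.mem_stabilizer_iff,
      MulAction.mem_stabilizer_iff, ovoidVec_eq s, ovoidVec_eq t, h]
    rcases hsign s t with hst | hst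
    · rw [hst]
    · rw [hst, neg_smul, smul_neg, neg_inj]

/-- The points of the Ree unital. -/
def unitalPoint (i : Fin 28) : UnitalPoint Ree3 := sylowThree (i.castLE (by decide))

/-- Words for `23` involutions; the first seven lie in a common Sylow `2`-subgroup. -/
def involutionWord : Fin 23 → List (Fin 8) := ![
    [6], [7], [7, 6], [2, 7, 3], [2, 7, 6, 3], [3, 7, 2], [3, 7, 6, 2], [6, 2, 1], [6, 1, 2],
    [1, 7, 4, 3, 0], [6, 0, 2], [0, 0, 7, 4, 0], [7, 1, 2, 7, 6], [6, 4], [4, 7, 6, 5],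
    [7, 5, 7, 6], [7, 4, 7, 6], [1, 7, 0, 7, 0], [6, 0, 1, 0], [7, 2, 1, 7, 5], [5, 7, 4],
    [7, 4, 7, 2, 0], [5, 7, 6, 4]]

/-- The ovoid points fixed by the involutions `involutionWord`. -/
def blockPoints : Fin 23 → Finset (Fin 28) := ![
    {0, 1, 4, 7}, {2, 6, 13, 22}, {5, 9, 15, 20}, {16, 18, 23, 25}, {12, 14, 26, 27},
    {10, 17, 19, 21}, {3, 8, 11, 24}, {0, 21, 24, 27}, {0, 12, 15, 18}, {8, 13, 18, 27},
    {0, 20, 23, 26}, {15, 19, 23, 24}, {1, 15, 16, 27}, {0, 10, 13, 16}, {2, 14, 18, 24},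
    {1, 13, 17, 23}, {1, 18, 21, 22}, {8, 9, 21, 23}, {0, 2, 5, 8}, {2, 15, 21, 26},
    {4, 13, 20, 24}, {2, 19, 20, 27}, {6, 11, 23, 27}]

lemma word_smul_unitalPoint_eq_iff (j : Fin 23) (i : Fin 28) :
    word (involutionWord j) • unitalPoint i = unitalPoint i ↔ i ∈ blockPoints j := by
  have h : ∀ (j : Fin 23) (i : Fin 28),
      unsign (moveWord (involutionWord j) (i.castLE (by decide))) = unsign (i.castLE (by decide)) ↔
        i ∈ blockPoints j := by decide +kernel
  rw [unitalPoint, word_smul_sylowThree, sylowThree_eq_iff, h]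

lemma orderOf_word_involutionWord (j : Fin 23) : orderOf (word (involutionWord j)) = 2 := by
  have hsq : ∀ j s, moveWord (involutionWord j ++ involutionWord j) s = moveWord [] s := by
    decide +kernel
  have hne : ∀ j, ∃ i, i ∉ blockPoints j := by decide +kernel
  refine orderOf_eq_prime ?_ fun h => ?_
  · rw [sq, ← word_append]
    exact word_eq_word (hsq j)
  · obtain ⟨i, hi⟩ := hne j
    exact hi ((word_smul_unitalPoint_eq_iff j i).1 (by rw [h, one_smul]))

/-- Words for the elements of a Sylow `2`-subgroup. -/
def sylowTwoWord (i : Fin 8) : List (Fin 8) :=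
  if h : i = 0 then [] else involutionWord ((i.pred h).castLE (by decide))

/-- The involutions are numbered so that multiplication is bitwise xor of indices, as in 𝔽₂³. -/
lemma exists_sylowTwoWord_mul (i j : Fin 8) :
    ∃ k, word (sylowTwoWord i) * word (sylowTwoWord j) = word (sylowTwoWord k) := by
  have h : ∀ i j : Fin 8, ∀ s, moveWord (sylowTwoWord i ++ sylowTwoWord j) s =
      moveWord (sylowTwoWord ⟨(i.1 ^^^ j.1) % 8, Nat.mod_lt _ (by decide)⟩) s := by
    decide +kernel
  exact ⟨_, by rw [← word_append]; exact word_eq_word (h i j)⟩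

lemma sylowTwoWord_injective : Function.Injective fun i => word (sylowTwoWord i) := by
  have h : ∀ i j : Fin 8, moveWord (sylowTwoWord i) 0 = moveWord (sylowTwoWord j) 0 →
      moveWord (sylowTwoWord i) 2 = moveWord (sylowTwoWord j) 2 → i = j := by
    decide +kernel
  intro i j hij
  have key (s : Fin 56) : moveWord (sylowTwoWord i) s = moveWord (sylowTwoWord j) s :=
    ovoidVec_injective (by rw [← word_smul, ← word_smul]; exact congrArg (· • ovoidVec s) hij)
  exact h i j (key 0) (key 2)

/-- An elementary abelian Sylow `2`-subgroup of `Ree(3)`. -/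
def sylowTwoSubgroup : Subgroup Ree3 where
  carrier := Set.range fun i => word (sylowTwoWord i)
  mul_mem' := by
    rintro _ _ ⟨i, rfl⟩ ⟨j, rfl⟩
    obtain ⟨k, hk⟩ := exists_sylowTwoWord_mul i j
    exact ⟨k, hk.symm⟩
  one_mem' := ⟨0, rfl⟩
  inv_mem' := by
    rintro _ ⟨i, rfl⟩
    refine ⟨i, eq_inv_of_mul_eq_one_left ?_⟩
    by_cases h : i = 0
    · rw [h]
      exact one_mul _
    · simp only [sylowTwoWord, dif_neg h]
      rw [← sq, ← orderOf_word_involutionWord, pow_orderOf_eq_one]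

/-- Up to conjugation, a nontrivial element of a Sylow `2`-subgroup is one of the first seven
involutions. -/
lemma exists_conj_of_sylow_two (S : Sylow 2 Ree3) : ∃ g : Ree3, ∀ a ∈ S, a ≠ 1 →
    ∃ j : Fin 7, a = g * word (involutionWord (j.castLE (by decide))) * g⁻¹ := by
  have hcard : Nat.card sylowTwoSubgroup = 2 ^ (Nat.card Ree3).factorization 2 := by
    rw [← Sylow.card_eq_multiplicity S, card_sylow_two]
    refine (Nat.card_range_of_injective sylowTwoWord_injective).trans ?_
    simp
  obtain ⟨g, hg⟩ := MulAction.exists_smul_eq Ree3 (Sylow.ofCard sylowTwoSubgroup hcard) S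
  refine ⟨g, fun a ha ha1 => ?_⟩
  rw [← hg] at ha
  obtain ⟨_, ⟨i, rfl⟩, hi⟩ := ha
  have h0 : i ≠ 0 := by
    rintro rfl
    apply ha1
    rw [← hi]
    exact map_one _
  refine ⟨i.pred h0, ?_⟩
  rw [← hi]
  simp only [sylowTwoWord, dif_neg h0]
  rfl

/-- The blocks of the Ree unital attached to the conjugates of the involutions. -/
lemma smul_unitalPoint_mem_iff (g : Ree3) (j : Fin 23) (i : Fin 28)
    (h : orderOf (g * word (involutionWord j) * g⁻¹) = 2) :
    g • unitalPoint i ∈ involutionBlock _ h ↔ i ∈ blockPoints j := by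
  rw [← word_smul_unitalPoint_eq_iff]
  change (g * word (involutionWord j) * g⁻¹) • g • unitalPoint i = g • unitalPoint i ↔ _
  rw [mul_smul, inv_smul_smul, mul_smul, smul_left_cancel_iff]

/-! ### Coordinates of an embedding -/

section Coordinates

variable {F : Type*} [Field F]

/-- The vector `x` is a nonzero multiple of `v`. -/
def HasCoords (x v : Fin 3 → F) : Prop := ∃ c : F, c ≠ 0 ∧ x = c • v

lemma HasCoords.dotProduct_eq_zero_iff {y w : Fin 3 → F} (h : HasCoords y w) (x : Fin 3 → F) :
    x ⬝ᵥ y = 0 ↔ x 0 * w 0 + x 1 * w 1 + x 2 * w 2 = 0 := by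
  obtain ⟨c, hc, rfl⟩ := h
  rw [dotProduct_smul, smul_eq_zero_iff_right hc, dotProduct, Fin.sum_univ_three]

lemma exists_smul_of_crossProduct_eq_zero {u v : Fin 3 → F} (hu : u ≠ 0)
    (h : crossProduct u v = 0) : ∃ c : F, c • u = v := by
  by_contra! hc
  exact crossProduct_ne_zero_iff_linearIndependent.2 ((LinearIndependent.pair_iff' hu).2 hc) h

/-- The line through two points, given by coordinates. -/
lemma hasCoords_of_dotProduct_eq_zero {p q l z u v w : Fin 3 → F} (hu : HasCoords p u)
    (hv : HasCoords q v) (hpl : p ⬝ᵥ l = 0) (hql : q ⬝ᵥ l = 0) (hpz : p ⬝ᵥ z = 0)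
    (hqz : q ⬝ᵥ z ≠ 0) (hp : p ≠ 0) (hl : l ≠ 0) (hw : w ≠ 0) (huw : u ⬝ᵥ w = 0)
    (hvw : v ⬝ᵥ w = 0) : HasCoords l w := by
  have hpw : p ⬝ᵥ w = 0 := by
    obtain ⟨c, -, rfl⟩ := hu
    rw [smul_dotProduct, huw, smul_zero]
  have hqw : q ⬝ᵥ w = 0 := by
    obtain ⟨c, -, rfl⟩ := hv
    rw [smul_dotProduct, hvw, smul_zero]
  -- Either p and q are proportional or l and w are; the line z through p but not q excludes the
  -- former.
  rcases Configuration.ofField.crossProduct_eq_zero_of_dotProduct_eq_zero hpw hqw hpl hql with h | h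
  · obtain ⟨c, rfl⟩ := exists_smul_of_crossProduct_eq_zero hp h
    rw [smul_dotProduct, hpz, smul_zero] at hqz
    exact absurd rfl hqz
  · obtain ⟨c, rfl⟩ := exists_smul_of_crossProduct_eq_zero hw h
    exact ⟨c, fun hc => hl (by rw [hc, zero_smul]), rfl⟩

/-- Vectors `x i` and `y j` that represent the points and some blocks of the Ree unital by points
and lines of a projective plane. -/
def IsRealization (x : Fin 28 → Fin 3 → F) (y : Fin 23 → Fin 3 → F) : Prop :=
  ∀ i j, x i ⬝ᵥ y j = 0 ↔ i ∈ blockPoints j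

namespace IsRealization

variable {x : Fin 28 → Fin 3 → F} {y : Fin 23 → Fin 3 → F}

lemma point_ne_zero (H : IsRealization x y) (i : Fin 28) : x i ≠ 0 := by
  intro h
  have key : ∀ i, ∃ j, i ∉ blockPoints j := by decide +kernel
  obtain ⟨j, hj⟩ := key i
  exact hj ((H i j).1 (by rw [h, zero_dotProduct]))

lemma line_ne_zero (H : IsRealization x y) (j : Fin 23) : y j ≠ 0 := by
  intro h
  have key : ∀ j, ∃ i, i ∉ blockPoints j := by decide +kernel
  obtain ⟨i, hi⟩ := key j
  exact hi ((H i j).1 (by rw [h, dotProduct_zero]))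

lemma mem_iff (H : IsRealization x y) {i : Fin 28} {j : Fin 23} {u₀ u₁ u₂ w₀ w₁ w₂ : F}
    (hu : HasCoords (x i) ![u₀, u₁, u₂]) (hw : HasCoords (y j) ![w₀, w₁, w₂]) :
    u₀ * w₀ + u₁ * w₁ + u₂ * w₂ = 0 ↔ i ∈ blockPoints j := by
  rw [← H, hw.dotProduct_eq_zero_iff]
  obtain ⟨c, hc, h⟩ := hu
  have : x i 0 * w₀ + x i 1 * w₁ + x i 2 * w₂ = c * (u₀ * w₀ + u₁ * w₁ + u₂ * w₂) := by
    simp [h]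
    ring
  simp [this, hc]

/-- The coordinates of the line through two points. -/
lemma line (H : IsRealization x y) {i k : Fin 28} {j : Fin 23} {u₀ u₁ u₂ v₀ v₁ v₂ w₀ w₁ w₂ : F}
    (hu : HasCoords (x i) ![u₀, u₁, u₂]) (hv : HasCoords (x k) ![v₀, v₁, v₂])
    (h : i ∈ blockPoints j ∧ k ∈ blockPoints j ∧ ∃ m, i ∈ blockPoints m ∧ k ∉ blockPoints m)
    (r : Fin 3) (hr : ![w₀, w₁, w₂] r = 1)
    (huw : u₀ * w₀ + u₁ * w₁ + u₂ * w₂ = 0) (hvw : v₀ * w₀ + v₁ * w₁ + v₂ * w₂ = 0) :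
    HasCoords (y j) ![w₀, w₁, w₂] := by
  -- Block m separates the two points, and the coordinate 1 at position r keeps w nonzero whatever
  -- the parameters are.
  obtain ⟨hi, hk, m, him, hkm⟩ := h
  refine hasCoords_of_dotProduct_eq_zero hu hv ((H i j).2 hi) ((H k j).2 hk) ((H i m).2 him)
    (fun h => hkm ((H k m).1 h)) (H.point_ne_zero i) (H.line_ne_zero j) ?_ ?_ ?_
  · intro h
    rw [h] at hr
    exact zero_ne_one hr
  · simpa [dotProduct, Fin.sum_univ_three] using huw
  · simpa [dotProduct, Fin.sum_univ_three] using hvw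

/-- The coordinates of the intersection of two lines. -/
lemma point (H : IsRealization x y) {i : Fin 28} {j k : Fin 23} {u₀ u₁ u₂ v₀ v₁ v₂ w₀ w₁ w₂ : F}
    (hu : HasCoords (y j) ![u₀, u₁, u₂]) (hv : HasCoords (y k) ![v₀, v₁, v₂])
    (h : i ∈ blockPoints j ∧ i ∈ blockPoints k ∧ ∃ m, m ∈ blockPoints j ∧ m ∉ blockPoints k)
    (r : Fin 3) (hr : ![w₀, w₁, w₂] r = 1)
    (huw : u₀ * w₀ + u₁ * w₁ + u₂ * w₂ = 0) (hvw : v₀ * w₀ + v₁ * w₁ + v₂ * w₂ = 0) :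
    HasCoords (x i) ![w₀, w₁, w₂] := by
  obtain ⟨hj, hk, m, hmj, hmk⟩ := h
  have H' : ∀ i j, y j ⬝ᵥ x i = 0 ↔ i ∈ blockPoints j := fun i j => by
    rw [dotProduct_comm, H]
  refine hasCoords_of_dotProduct_eq_zero hu hv ((H' i j).2 hj) ((H' i k).2 hk) ((H' m j).2 hmj)
    (fun h => hmk ((H' m k).1 h)) (H.line_ne_zero j) (H.point_ne_zero i) ?_ ?_ ?_
  · intro h
    rw [h] at hr
    exact zero_ne_one hr
  · simpa [dotProduct, Fin.sum_univ_three] using huw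
  · simpa [dotProduct, Fin.sum_univ_three] using hvw

/-- If four points form the standard frame, then `F` has characteristic `2`, it contains a root
of `X ^ 3 + X + 1`, and the first seven lines are concurrent. -/
lemma exists_concurrent_of_frame (H : IsRealization x y)
    (hx27 : HasCoords (x 27) ![1, 0, 0]) (hx23 : HasCoords (x 23) ![0, 1, 0]) (hx0 : HasCoords (x 0) ![0, 0, 1])
    (hx18 : HasCoords (x 18) ![1, 1, 1]) :
    ∃ X : Fin 3 → F, X ≠ 0 ∧ ∀ j : Fin 7, X ⬝ᵥ y (j.castLE (by decide)) = 0 := by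
  have hy3 : HasCoords (y 3) ![1, 0, -1] :=
    H.line hx23 hx18 (by decide) 0 rfl (by ring) (by ring)
  have hy7 : HasCoords (y 7) ![0, 1, 0] :=
    H.line hx27 hx0 (by decide) 1 rfl (by ring) (by ring)
  have hy8 : HasCoords (y 8) ![-1, 1, 0] :=
    H.line hx0 hx18 (by decide) 1 rfl (by ring) (by ring)
  have hy9 : HasCoords (y 9) ![0, -1, 1] :=
    H.line hx27 hx18 (by decide) 2 rfl (by ring) (by ring)
  have hy10 : HasCoords (y 10) ![1, 0, 0] :=
    H.line hx23 hx0 (by decide) 0 rfl (by ring) (by ring)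
  obtain ⟨a, ha, hx24⟩ : ∃ a : F, a ≠ 0 ∧ HasCoords (x 24) ![1, 0, a] := by
    have h1 : x 24 1 = 0 := by
      simpa using (hy7.dotProduct_eq_zero_iff (x 24)).1 ((H 24 7).2 (by decide))
    have h0 : x 24 0 ≠ 0 := fun h => absurd
      ((H 24 10).1 ((hy10.dotProduct_eq_zero_iff (x 24)).2 (by simpa using h))) (by decide)
    have h2 : x 24 2 ≠ 0 := fun h => absurd
      ((H 24 9).1 ((hy9.dotProduct_eq_zero_iff (x 24)).2 (by simp [h, h1]))) (by decide)
    refine ⟨x 24 2 / x 24 0, div_ne_zero h2 h0, x 24 0, h0, ?_⟩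
    ext r
    fin_cases r
    · simp
    · simp [h1]
    · simp [mul_div_cancel₀ _ h0]
  have hy11 : HasCoords (y 11) ![-a, 0, 1] :=
    H.line hx23 hx24 (by decide) 2 rfl (by ring) (by ring)
  have hx15 : HasCoords (x 15) ![1, 1, a] :=
    H.point hy8 hy11 (by decide) 0 rfl (by ring) (by ring)
  have hy12 : HasCoords (y 12) ![0, -a, 1] :=
    H.line hx27 hx15 (by decide) 2 rfl (by ring) (by ring)
  have hx16 : HasCoords (x 16) ![a, 1, a] :=
    H.point hy12 hy3 (by decide) 1 rfl (by ring) (by ring)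
  have hy13 : HasCoords (y 13) ![1, -a, 0] :=
    H.line hx16 hx0 (by decide) 0 rfl (by ring) (by ring)
  have hx13 : HasCoords (x 13) ![a, 1, 1] :=
    H.point hy9 hy13 (by decide) 1 rfl (by ring) (by ring)
  have hy14 : HasCoords (y 14) ![-a, a - 1, 1] :=
    H.line hx24 hx18 (by decide) 2 rfl (by ring) (by ring)
  have hy15 : HasCoords (y 15) ![1, 0, -a] :=
    H.line hx23 hx13 (by decide) 0 rfl (by ring) (by ring)
  have hx1 : HasCoords (x 1) ![a ^ 2, 1, a] :=
    H.point hy12 hy15 (by decide) 1 rfl (by ring) (by ring)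
  have hy16 : HasCoords (y 16) ![1, a, -a - 1] :=
    H.line hx1 hx18 (by decide) 0 rfl (by ring) (by ring)
  have hx21 : HasCoords (x 21) ![a + 1, 0, 1] :=
    H.point hy7 hy16 (by decide) 2 rfl (by ring) (by ring)
  have hy17 : HasCoords (y 17) ![1, 0, -a - 1] :=
    H.line hx21 hx23 (by decide) 0 rfl (by ring) (by ring)
  have hx8 : HasCoords (x 8) ![a + 1, 1, 1] :=
    H.point hy9 hy17 (by decide) 1 rfl (by ring) (by ring)
  have hy18 : HasCoords (y 18) ![1, -a - 1, 0] :=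
    H.line hx0 hx8 (by decide) 0 rfl (by ring) (by ring)
  have hx2 : HasCoords (x 2) ![a + 1, 1, a ^ 2 + 1] :=
    H.point hy14 hy18 (by decide) 1 rfl (by ring) (by ring)
  have hy19 : HasCoords (y 19) ![1, a ^ 2 + a - 1, -a - 1] :=
    H.line hx21 hx15 (by decide) 0 rfl (by ring) (by ring)
  have hcub : a ^ 3 - a + 1 = 0 := by
    linear_combination -(H.mem_iff hx2 hy19).2 (by decide)
  have hy20 : HasCoords (y 20) ![-a, a ^ 2 - 1, 1] :=
    H.line hx24 hx13 (by decide) 2 rfl (by ring) (by ring)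
  have hy21 : HasCoords (y 21) ![0, -a ^ 2 - 1, 1] :=
    H.line hx27 hx2 (by decide) 2 rfl (by ring) (by ring)
  have hx20 : HasCoords (x 20) ![2 * a, 1, a ^ 2 + 1] :=
    H.point hy20 hy21 (by decide) 1 rfl (by ring) (by ring)
  have h2 : (2 : F) = 0 := by
    have h := (H.mem_iff hx20 hy10).2 (by decide)
    refine (mul_eq_zero.1 (?_ : 2 * a = 0)).resolve_right ha
    linear_combination h
  -- From here on, identities hold only modulo 2 and a³ - a + 1; the coefficients below are the
  -- cofactors.
  have hy1 : HasCoords (y 1) ![a, 1, a ^ 2 + 1] :=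
    H.line hx2 hx13 (by decide) 1 rfl
      (by linear_combination a * hcub + (2 * a ^ 2 + 1) * h2)
      (by linear_combination (a ^ 2 + 1) * h2)
  have hy2 : HasCoords (y 2) ![1, a, a ^ 2] :=
    H.line hx15 hx20 (by decide) 0 rfl
      (by linear_combination hcub + a * h2)
      (by linear_combination a * hcub + (a ^ 2 + a) * h2)
  have hy6 : HasCoords (y 6) ![a + 1, 1, a ^ 2] :=
    H.line hx24 hx8 (by decide) 1 rfl
      (by linear_combination hcub + a * h2)
      (by linear_combination (a ^ 2 + a + 1) * h2)
  have hy0 : HasCoords (y 0) ![1, a ^ 2, 0] :=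
    H.line hx0 hx1 (by decide) 0 rfl (by ring)
      (by linear_combination a ^ 2 * h2)
  have hx19 : HasCoords (x 19) ![1, a ^ 2, a] :=
    H.point hy21 hy11 (by decide) 0 rfl
      (by linear_combination -a * hcub + (-a ^ 2 + a) * h2) (by ring)
  have hy5 : HasCoords (y 5) ![1, a + 1, a + 1] :=
    H.line hx19 hx21 (by decide) 0 rfl
      (by linear_combination hcub + (a ^ 2 + a) * h2)
      (by linear_combination (a + 1) * h2)
  have hx26 : HasCoords (x 26) ![0, 1, a ^ 2] :=
    H.point hy19 hy10 (by decide) 1 rfl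
      (by linear_combination -hcub) (by ring)
  have hy4 : HasCoords (y 4) ![0, 1, a ^ 2 + a + 1] :=
    H.line hx27 hx26 (by decide) 1 rfl (by ring)
      (by linear_combination (a + 1) * hcub + a ^ 2 * h2)
  refine ⟨![1, a ^ 2 + a + 1, 1], fun h => one_ne_zero (congrFun h 0), fun j => ?_⟩
  fin_cases j
  · refine (hy0.dotProduct_eq_zero_iff _).2 ?_
    simp only [Matrix.cons_val]
    linear_combination (a + 1) * hcub + a ^ 2 * h2
  · refine (hy1.dotProduct_eq_zero_iff _).2 ?_
    simp only [Matrix.cons_val]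
    linear_combination (a ^ 2 + a + 1) * h2
  · refine (hy2.dotProduct_eq_zero_iff _).2 ?_
    simp only [Matrix.cons_val]
    linear_combination hcub + (a ^ 2 + a) * h2
  · refine (hy3.dotProduct_eq_zero_iff _).2 ?_
    simp only [Matrix.cons_val]
    ring
  · refine (hy4.dotProduct_eq_zero_iff _).2 ?_
    simp only [Matrix.cons_val]
    linear_combination (a ^ 2 + a + 1) * h2
  · refine (hy5.dotProduct_eq_zero_iff _).2 ?_
    simp only [Matrix.cons_val]
    linear_combination hcub + (a ^ 2 + 2 * a + 1) * h2
  · refine (hy6.dotProduct_eq_zero_iff _).2 ?_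
    simp only [Matrix.cons_val]
    linear_combination (a ^ 2 + a + 1) * h2

/-- The first seven lines are concurrent. -/
theorem exists_concurrent (H : IsRealization x y) :
    ∃ X : Fin 3 → F, X ≠ 0 ∧ ∀ j : Fin 7, X ⬝ᵥ y (j.castLE (by decide)) = 0 := by
  have ne {i : Fin 28} {j : Fin 23} (h : i ∉ blockPoints j) : x i ⬝ᵥ y j ≠ 0 :=
    fun h' => h ((H i j).1 h')
  -- The rows are the sides of the triangle 27, 23, 0, scaled to take the value 1 at point 18, so N
  -- carries these four points to the standard frame.
  set N : Matrix (Fin 3) (Fin 3) F :=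
    .of ![(x 18 ⬝ᵥ y 10)⁻¹ • y 10, (x 18 ⬝ᵥ y 7)⁻¹ • y 7, (x 18 ⬝ᵥ y 22)⁻¹ • y 22]
  have hNx (v : Fin 3 → F) : N *ᵥ v = ![(x 18 ⬝ᵥ y 10)⁻¹ * (v ⬝ᵥ y 10),
      (x 18 ⬝ᵥ y 7)⁻¹ * (v ⬝ᵥ y 7), (x 18 ⬝ᵥ y 22)⁻¹ * (v ⬝ᵥ y 22)] := by
    have row (c : F) (u : Fin 3 → F) : (c • u) ⬝ᵥ v = c * (v ⬝ᵥ u) := by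
      rw [smul_dotProduct, dotProduct_comm, smul_eq_mul]
    ext r
    fin_cases r
    exacts [row _ _, row _ _, row _ _]
  have h18₀ : x 18 ⬝ᵥ y 10 ≠ 0 := ne (by decide)
  have h18₁ : x 18 ⬝ᵥ y 7 ≠ 0 := ne (by decide)
  have h18₂ : x 18 ⬝ᵥ y 22 ≠ 0 := ne (by decide)
  have h27 : HasCoords (N *ᵥ x 27) ![1, 0, 0] := by
    refine ⟨_, mul_ne_zero (inv_ne_zero h18₀) (ne (i := 27) (j := 10) (by decide)), ?_⟩
    rw [hNx, (H 27 7).2 (by decide), (H 27 22).2 (by decide)]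
    simp
  have h23 : HasCoords (N *ᵥ x 23) ![0, 1, 0] := by
    refine ⟨_, mul_ne_zero (inv_ne_zero h18₁) (ne (i := 23) (j := 7) (by decide)), ?_⟩
    rw [hNx, (H 23 10).2 (by decide), (H 23 22).2 (by decide)]
    simp
  have h0 : HasCoords (N *ᵥ x 0) ![0, 0, 1] := by
    refine ⟨_, mul_ne_zero (inv_ne_zero h18₂) (ne (i := 0) (j := 22) (by decide)), ?_⟩
    rw [hNx, (H 0 10).2 (by decide), (H 0 7).2 (by decide)]
    simp
  have h18 : HasCoords (N *ᵥ x 18) ![1, 1, 1] := by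
    refine ⟨1, one_ne_zero, ?_⟩
    rw [hNx, inv_mul_cancel₀ h18₀, inv_mul_cancel₀ h18₁, inv_mul_cancel₀ h18₂, one_smul]
  have hsurj : Function.Surjective N.mulVec := by
    obtain ⟨c₀, hc₀, e₀⟩ := h27
    obtain ⟨c₁, hc₁, e₁⟩ := h23
    obtain ⟨c₂, hc₂, e₂⟩ := h0
    intro v
    refine ⟨(v 0 / c₀) • x 27 + (v 1 / c₁) • x 23 + (v 2 / c₂) • x 0, ?_⟩
    rw [Matrix.mulVec_add, Matrix.mulVec_add, Matrix.mulVec_smul, Matrix.mulVec_smul,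
      Matrix.mulVec_smul, e₀, e₁, e₂]
    ext r
    fin_cases r <;> simp [hc₀, hc₁, hc₂]
  have hunit : IsUnit N.det :=
    (Matrix.isUnit_iff_isUnit_det N).1 (Matrix.mulVec_surjective_iff_isUnit.1 hsurj)
  have hdot (u v : Fin 3 → F) : u ⬝ᵥ (v ᵥ* N⁻¹) = (N⁻¹ *ᵥ u) ⬝ᵥ v := by
    rw [dotProduct_comm, ← Matrix.dotProduct_mulVec, dotProduct_comm]
  have hinv (v : Fin 3 → F) : N⁻¹ *ᵥ (N *ᵥ v) = v := by
    rw [Matrix.mulVec_mulVec, Matrix.nonsing_inv_mul _ hunit, Matrix.one_mulVec]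
  -- Points move by N and lines by its inverse, so the incidence pairing is preserved.
  have H' : IsRealization (fun i => N *ᵥ x i) (fun j => y j ᵥ* N⁻¹) := fun i j => by
    rw [hdot, hinv, H]
  obtain ⟨X, hX, hXy⟩ := H'.exists_concurrent_of_frame h27 h23 h0 h18
  refine ⟨N⁻¹ *ᵥ X, fun h => hX ?_, fun j => by rw [← hdot, hXy]⟩
  rw [← Matrix.one_mulVec X, ← Matrix.mul_nonsing_inv _ hunit, ← Matrix.mulVec_mulVec, h,
    Matrix.mulVec_zero]

end IsRealization

end Coordinates

end ReeThree

theorem mainTheorem4 (F : Type*) [Field F]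
    (φ : IncidenceEmbedding (UnitalPoint Ree3) (UnitalBlock Ree3) (PGPoint F) (PGLine F))
    (S : Sylow 2 Ree3) :
    Nat.card S = 8 ∧
      ∃ X : PGPoint F, ∀ a : Ree3, a ∈ S → a ≠ 1 →
        ∃ ha : orderOf a = 2, X ∈ φ.onBlocks (involutionBlock a ha) := by
  refine ⟨ReeThree.card_sylow_two S, ?_⟩
  obtain ⟨g, hg⟩ := ReeThree.exists_conj_of_sylow_two S
  have hord (j : Fin 23) :
      orderOf (g * ReeThree.word (ReeThree.involutionWord j) * g⁻¹) = 2 :=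
    (orderOf_injective (MulAut.conj g).toMonoidHom (MulAut.conj g).injective _).trans
      (ReeThree.orderOf_word_involutionWord j)
  have hmk (P : PGPoint F) (L : PGLine F) : P.rep ⬝ᵥ L.rep = 0 ↔ P ∈ L := by
    rw [Configuration.ofField.mem_iff]
    conv_rhs => rw [← P.mk_rep, ← L.mk_rep]
    exact (Projectivization.orthogonal_mk P.rep_nonzero L.rep_nonzero).symm
  -- Translating points by g and conjugating involutions by g keeps the incidences of `blockPoints`,
  -- and the first seven blocks become those of S.
  have H : ReeThree.IsRealization
      (fun i => (φ.onPoints (g • ReeThree.unitalPoint i)).rep)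
      (fun j => (φ.onBlocks (involutionBlock _ (hord j))).rep) := fun i j => by
    rw [hmk, ← φ.mem_iff, ReeThree.smul_unitalPoint_mem_iff]
  obtain ⟨X, hX, hXy⟩ := H.exists_concurrent
  refine ⟨Projectivization.mk F X hX, fun a ha ha1 => ?_⟩
  obtain ⟨j, rfl⟩ := hg a ha ha1
  refine ⟨hord _, ?_⟩
  rw [Configuration.ofField.mem_iff, ← Projectivization.mk_rep (φ.onBlocks _)]
  exact (Projectivization.orthogonal_mk hX (Projectivization.rep_nonzero _)).2 (hXy j)
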